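/- All rings are associative with identity $1$, and isomorphisms preserve $1$. A ring $R$ is \emph{reflexive} if for all $a,b\in R$, $aRb=0$ implies $bRa=0$; it is \emph{duo} if for all $a,b\in R$ both $ba\in aR$ and $ba\in Rb$ (equivalently, every one-sided ideal of $R$ is two-sided). A \emph{minimal nonreflexive duo ring} is a duo ring that is not reflexive and whose cardinality is least among all duo rings that are not reflexive. For a commutative ring $k$, let $k\langle u,v\rangle$ denote the free associative $k$-algebra on two noncommuting generators $u,v$, and let $\langle\cdots\rangle$ denote the two-sided ideal generated by the listed elements. \textbf{Theorem (Minimal Nonreflexive Duo).} Every minimal nonreflexive duo ring has order $16$. A ring is a minimal nonreflexive duo ring if and only if it is isomorphic to one of the two rings $$\frac{\mathbb{F}_2\langle u,v\rangle}{\langle u^3,\;v^3,\;vu,\;u^2-uv,\;v^2-uv\rangle}\qquad\text{and}\qquad \frac{\mathbb{Z}_4\langle u,v\rangle}{\langle u^3,\;v^3,\;vu,\;u^2-uv,\;v^2-uv,\;2-uv,\;2u,\;2v\rangle},$$ where $\mathbb{Z}_4=\mathbb{Z}/4\mathbb{Z}$, and these two rings are not isomorphic to each other. -/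

import Mathlib

universe u

/-- `R` is reflexive: `aRb = 0` implies `bRa = 0`. -/
def IsReflexiveRing (R : Type u) [Ring R] : Prop :=
  ∀ a b : R, (∀ r : R, a * r * b = 0) → ∀ r : R, b * r * a = 0

/-- `R` is right duo: `ba ∈ aR` for all `a, b`. -/
def IsRightDuoRing (R : Type u) [Ring R] : Prop :=
  ∀ a b : R, ∃ c : R, b * a = a * c

/-- `R` is left duo: `ba ∈ Rb` for all `a, b`. -/
def IsLeftDuoRing (R : Type u) [Ring R] : Prop :=
  ∀ a b : R, ∃ c : R, b * a = c * b

/-- `R` is duo: both right and left duo. -/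
def IsDuoRing (R : Type u) [Ring R] : Prop :=
  IsRightDuoRing R ∧ IsLeftDuoRing R

/-- `R` is a minimal nonreflexive duo ring: it is duo and not reflexive, and its cardinality is
least among all (finite or infinite) nonreflexive duo rings. -/
def IsMinimalNonreflexiveDuoRing (R : Type u) [Ring R] : Prop :=
  (IsDuoRing R ∧ ¬ IsReflexiveRing R) ∧
    ∀ (S : Type u) [Ring S], IsDuoRing S → ¬ IsReflexiveRing S →
      Cardinal.mk R ≤ Cardinal.mk S

/-- The first free generator of `k⟨u, v⟩`. -/
def genU (k : Type) [CommRing k] : FreeAlgebra k (Fin 2) := FreeAlgebra.ι k 0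

/-- The second free generator of `k⟨u, v⟩`. -/
def genV (k : Type) [CommRing k] : FreeAlgebra k (Fin 2) := FreeAlgebra.ι k 1

/-- The two-sided ideal `(u³, v³, vu, u² - uv, v² - uv)` of `𝔽₂⟨u, v⟩`. -/
def idealF2 : TwoSidedIdeal (FreeAlgebra (ZMod 2) (Fin 2)) :=
  let u := genU (ZMod 2)
  let v := genV (ZMod 2)
  TwoSidedIdeal.span {u ^ 3, v ^ 3, v * u, u ^ 2 - u * v, v ^ 2 - u * v}

/-- The ring `𝔽₂⟨u, v⟩ / (u³, v³, vu, u² - uv, v² - uv)`. -/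
abbrev RingF2 : Type := idealF2.ringCon.Quotient

/-- The two-sided ideal `(u³, v³, vu, u² - uv, v² - uv, 2 - uv, 2u, 2v)` of `ℤ₄⟨u, v⟩`. -/
def idealZ4 : TwoSidedIdeal (FreeAlgebra (ZMod 4) (Fin 2)) :=
  let u := genU (ZMod 4)
  let v := genV (ZMod 4)
  TwoSidedIdeal.span
    {u ^ 3, v ^ 3, v * u, u ^ 2 - u * v, v ^ 2 - u * v, 2 - u * v, 2 * u, 2 * v}

/-- The ring `ℤ₄⟨u, v⟩ / (u³, v³, vu, u² - uv, v² - uv, 2 - uv, 2u, 2v)`. -/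
abbrev RingZ4 : Type := idealZ4.ringCon.Quotient

/-!
In a duo ring, `ab = 0` implies `aRb = 0`, so reflexivity amounts to reversibility: a duo ring is
nonreflexive exactly when it has elements with `vu = 0` and `uv ≠ 0`.

Consider such a ring `R` of order at most `16`. If some nonzero principal ideal misses `s = uv`, the
quotient by it is a smaller nonreflexive duo ring, so by induction on the order every nonzero ideal may
be assumed to contain `s`. Then `R` has no idempotents besides `0` and `1`, and being finite, each of its
elements is nilpotent or a unit. This gives strict inclusions `0 < sR < uR` and `0 < sR < vR`. If `uR`
and `vR` were comparable, the larger one, say `wR`, would sit in a chain `0 < sR < · < wR < R`, of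
index two at every step, so that `R = {0, 1} + wR` and `w` is central, against `uv ≠ vu`
(`notMem_rightMultiples`). So `0 < sR < uR < uR + vR < R` is a chain of strict inclusions, whence `R`
has order `16` and all indices are two. The few remaining possibilities for `u²`, `v²` and `2` are cut
down by the duo condition and by the centrality of `2` to `u² = v² = uv` and `2 ∈ {0, s}`
(`exists_socleRelations_of_local`).

The two values of `2` correspond to two explicit rings `SocleModel t` on four bits, `2 = t s`. They are
nonreflexive duo rings of order `16`. As each nonzero ideal of `SocleModel t` contains `s`, any homomorphism
out of it that does not kill `s` is injective (`SocleRelations.hom_injective`); this identifies `R`,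
by its order, and the two given presentations, by their generators, with `SocleModel t`.
The two models are distinguished by whether `2 = 0`.
-/

/-! ### The two rings on four bits -/

/-- The ring of order `16` on bits `(a, b, c, d)`, read as `a + b u + c v + d s` with
`u² = v² = uv = s`, `vu = 0`, `us = su = vs = sv = s² = 0` and `2 = t s`. It is a model of
`𝔽₂⟨u, v⟩ / (…)` for `t = 0` and of `ℤ₄⟨u, v⟩ / (…)` for `t = 1`. The value of `t` enters only through
addition: `1 + 1 = t s` makes the `1`-coordinates carry into the `s`-coordinate. -/
@[ext]
structure SocleModel (t : ZMod 2) where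
  one : ZMod 2
  u : ZMod 2
  v : ZMod 2
  s : ZMod 2

namespace SocleModel

variable {t : ZMod 2}

lemma bit_mul_self (a : ZMod 2) : a * a = a := by revert a; decide

lemma bit_add_self (a : ZMod 2) : a + a = 0 := by revert a; decide

instance : Zero (SocleModel t) := ⟨⟨0, 0, 0, 0⟩⟩

instance : One (SocleModel t) := ⟨⟨1, 0, 0, 0⟩⟩

instance : Add (SocleModel t) :=
  ⟨fun x y => ⟨x.one + y.one, x.u + y.u, x.v + y.v, x.s + y.s + t * (x.one * y.one)⟩⟩

instance : Neg (SocleModel t) := ⟨fun x => ⟨x.one, x.u, x.v, x.s + t * x.one⟩⟩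

instance : Mul (SocleModel t) :=
  ⟨fun x y => ⟨x.one * y.one, x.one * y.u + x.u * y.one, x.one * y.v + x.v * y.one,
    x.one * y.s + x.s * y.one + (x.u * y.u + x.u * y.v + x.v * y.v)⟩⟩

@[simp] lemma zero_def : (0 : SocleModel t) = ⟨0, 0, 0, 0⟩ := rfl

@[simp] lemma one_def : (1 : SocleModel t) = ⟨1, 0, 0, 0⟩ := rfl

@[simp] lemma add_def (x y : SocleModel t) :
    x + y = ⟨x.one + y.one, x.u + y.u, x.v + y.v, x.s + y.s + t * (x.one * y.one)⟩ := rfl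

@[simp] lemma neg_def (x : SocleModel t) : -x = ⟨x.one, x.u, x.v, x.s + t * x.one⟩ := rfl

@[simp] lemma mul_def (x y : SocleModel t) :
    x * y = ⟨x.one * y.one, x.one * y.u + x.u * y.one, x.one * y.v + x.v * y.one,
      x.one * y.s + x.s * y.one + (x.u * y.u + x.u * y.v + x.v * y.v)⟩ := rfl

instance : Ring (SocleModel t) where
  nsmul := nsmulRec
  zsmul := zsmulRec
  add_assoc x y z := by ext <;> simp <;> ring
  zero_add x := by ext <;> simp
  add_zero x := by ext <;> simp
  add_comm x y := by ext <;> simp <;> ring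
  neg_add_cancel x := by
    ext
    · simp [bit_add_self]
    · simp [bit_add_self]
    · simp [bit_add_self]
    · simp only [neg_def, add_def, zero_def]
      linear_combination bit_add_self x.s + bit_add_self (t * x.one) + t * bit_mul_self x.one
  mul_assoc x y z := by ext <;> simp <;> ring
  one_mul x := by ext <;> simp
  mul_one x := by ext <;> simp
  zero_mul x := by ext <;> simp
  mul_zero x := by ext <;> simp
  left_distrib x y z := by
    ext
    · simp; ring
    · simp; ring
    · simp; ring
    · simp only [mul_def, add_def]
      linear_combination -(t * y.one * z.one) * bit_mul_self x.one
  right_distrib x y z := by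
    ext
    · simp; ring
    · simp; ring
    · simp; ring
    · simp only [mul_def, add_def]
      linear_combination -(t * x.one * y.one) * bit_mul_self z.one

/-- The four coordinates. -/
def equivProd (t : ZMod 2) : SocleModel t ≃ ZMod 2 × ZMod 2 × ZMod 2 × ZMod 2 where
  toFun x := (x.one, x.u, x.v, x.s)
  invFun p := ⟨p.1, p.2.1, p.2.2.1, p.2.2.2⟩
  left_inv _ := rfl
  right_inv _ := rfl

lemma card : Nat.card (SocleModel t) = 16 := by
  rw [Nat.card_congr (equivProd t)]; simp

instance : Finite (SocleModel t) := .of_equiv _ (equivProd t).symm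

lemma bit_cases (a : ZMod 2) : a = 0 ∨ a = 1 := by revert a; decide

/-- Every nonzero right ideal contains the socle generator `s`. -/
lemma exists_mul_right_eq {x : SocleModel t} (hx : x ≠ 0) : ∃ y, x * y = ⟨0, 0, 0, 1⟩ := by
  obtain ⟨a, b, c, d⟩ := x
  rcases bit_cases a with rfl | rfl
  · rcases bit_cases b with rfl | rfl
    · rcases bit_cases c with rfl | rfl
      · rcases bit_cases d with rfl | rfl
        · exact absurd rfl hx
        · exact ⟨1, by simp⟩
      · exact ⟨⟨0, 0, 1, 0⟩, by simp⟩
    · exact ⟨⟨0, 1, 0, 0⟩, by simp⟩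
  · exact ⟨⟨0, 0, 0, 1⟩, by simp⟩

/-- Every nonzero left ideal contains the socle generator `s`. -/
lemma exists_mul_left_eq {x : SocleModel t} (hx : x ≠ 0) : ∃ y, y * x = ⟨0, 0, 0, 1⟩ := by
  obtain ⟨a, b, c, d⟩ := x
  rcases bit_cases a with rfl | rfl
  · rcases bit_cases c with rfl | rfl
    · rcases bit_cases b with rfl | rfl
      · rcases bit_cases d with rfl | rfl
        · exact absurd rfl hx
        · exact ⟨1, by simp⟩
      · exact ⟨⟨0, 1, 0, 0⟩, by simp⟩
    · exact ⟨⟨0, 0, 1, 0⟩, by simp⟩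
  · exact ⟨⟨0, 0, 0, 1⟩, by simp⟩

/-- Commutators lie in the socle `{0, s}`. -/
lemma mul_eq_or (x y : SocleModel t) : y * x = x * y ∨ y * x = x * y + ⟨0, 0, 0, 1⟩ := by
  rcases bit_cases (x.u * y.v + x.v * y.u) with h | h
  · left
    ext
    · simp; ring
    · simp; ring
    · simp; ring
    · simp only [mul_def]
      linear_combination -h + bit_add_self (x.v * y.u)
  · right
    ext
    · simp; ring
    · simp; ring
    · simp; ring
    · simp only [mul_def, add_def]
      linear_combination -h + bit_add_self (x.v * y.u) - bit_add_self 1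

/-- If `ba = ab + s`, the error term `s` is absorbed, as it is a one-sided multiple of any nonzero
element. -/
lemma isDuoRing : IsDuoRing (SocleModel t) := by
  constructor
  · intro a b
    by_cases ha : a = 0
    · exact ⟨0, by rw [ha, mul_zero, zero_mul]⟩
    obtain ⟨y, hy⟩ := exists_mul_right_eq ha
    rcases mul_eq_or a b with h | h
    · exact ⟨b, h⟩
    · exact ⟨b + y, by rw [mul_add, hy, h]⟩
  · intro a b
    by_cases hb : b = 0
    · exact ⟨0, by rw [hb, mul_zero, zero_mul]⟩
    obtain ⟨y, hy⟩ := exists_mul_left_eq hb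
    rcases mul_eq_or a b with h | h
    · exact ⟨a, h⟩
    · exact ⟨a + y, by rw [add_mul, hy, h]⟩

end SocleModel

/-- The relations satisfied by the elements `u`, `v` of `SocleModel t`; the socle generator `s` is
written `u * v`. -/
structure SocleRelations {R : Type*} [Ring R] (t : ZMod 2) (u v : R) : Prop where
  vu : v * u = 0
  uu : u * u = u * v
  vv : v * v = u * v
  uuv : u * (u * v) = 0
  two_u : u + u = 0
  two_v : v + v = 0
  two : (1 : R) + 1 = t.val • (u * v)

namespace SocleRelations

variable {R : Type*} [Ring R] {t : ZMod 2} {u v : R}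

lemma val_add_nsmul {x : R} (hx : x + x = 0) (a b : ZMod 2) :
    (a + b).val • x = a.val • x + b.val • x := by
  rcases SocleModel.bit_cases a with rfl | rfl <;>
  rcases SocleModel.bit_cases b with rfl | rfl <;>
  simp [hx, show (1 + 1 : ZMod 2) = 0 from rfl, ZMod.val_one]

lemma val_mul_nsmul (x : R) (a b : ZMod 2) :
    (a * b).val • x = a.val • b.val • x := by
  rcases SocleModel.bit_cases a with rfl | rfl <;> simp [ZMod.val_one]

/-- Adding multiples of `1` carries into the socle, as in the addition of `SocleModel t`. -/
lemma val_add_nsmul_one (h : (1 : R) + 1 = t.val • (u * v)) (a b : ZMod 2) :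
    (a + b).val • (1 : R) + (t * (a * b)).val • (u * v) = a.val • 1 + b.val • 1 := by
  rcases SocleModel.bit_cases a with rfl | rfl <;>
  rcases SocleModel.bit_cases b with rfl | rfl <;>
  simp [h, show (1 + 1 : ZMod 2) = 0 from rfl, ZMod.val_one]

/-- The ring homomorphism `(a, b, c, d) ↦ a + b u + c v + d uv`. Bits act through their representatives
in `{0, 1} ⊆ ℕ`. -/
def hom (h : SocleRelations t u v) : SocleModel t →+* R where
  toFun x := x.one.val • 1 + x.u.val • u + x.v.val • v + x.s.val • (u * v)
  map_zero' := by simp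
  map_one' := by simp [ZMod.val_one]
  map_add' x y := by
    have hs : u * v + u * v = 0 := by rw [← add_mul, h.two_u, zero_mul]
    have := val_add_nsmul_one h.two x.one y.one
    simp only [SocleModel.add_def, val_add_nsmul h.two_u, val_add_nsmul h.two_v, val_add_nsmul hs]
    linear_combination (norm := abel) this
  map_mul' x y := by
    have hs : u * v + u * v = 0 := by rw [← add_mul, h.two_u, zero_mul]
    have vuv : v * (u * v) = 0 := by rw [← mul_assoc, h.vu, zero_mul]
    have uvu : u * v * u = 0 := by rw [mul_assoc, h.vu, mul_zero]
    have uvv : u * v * v = 0 := by rw [mul_assoc, h.vv, h.uuv]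
    have uvuv : u * v * (u * v) = 0 := by rw [← mul_assoc, uvu, zero_mul]
    simp only [SocleModel.mul_def, val_add_nsmul h.two_u, val_add_nsmul h.two_v,
      val_add_nsmul hs, val_mul_nsmul, mul_add, add_mul, smul_mul_assoc, mul_smul_comm, h.vu, h.uu,
      h.vv, h.uuv, vuv, uvu, uvv, uvuv, one_mul, mul_one, smul_zero, add_zero]
    module

lemma hom_socle (h : SocleRelations t u v) : h.hom ⟨0, 0, 0, 1⟩ = u * v := by
  simp [hom, -ZMod.natCast_val, ZMod.val_one]

lemma hom_u (h : SocleRelations t u v) : h.hom ⟨0, 1, 0, 0⟩ = u := by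
  simp [hom, -ZMod.natCast_val, ZMod.val_one]

lemma hom_v (h : SocleRelations t u v) : h.hom ⟨0, 0, 1, 0⟩ = v := by
  simp [hom, -ZMod.natCast_val, ZMod.val_one]

/-- A nonzero kernel would contain the socle generator, whose image is `u * v`. -/
lemma hom_injective (h : SocleRelations t u v) (huv : u * v ≠ 0) :
    Function.Injective h.hom := by
  rw [injective_iff_map_eq_zero]
  intro x hx
  by_contra hx0
  obtain ⟨y, hy⟩ := SocleModel.exists_mul_right_eq hx0
  exact huv (by rw [← h.hom_socle, ← hy, map_mul, hx, zero_mul])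

end SocleRelations

/-! ### Duo rings -/

section DuoRings

variable {R : Type*} [Ring R]

lemma IsDuoRing.mul_mul_eq_zero (h : IsDuoRing R) {a b : R} (hab : a * b = 0) (r : R) :
    a * r * b = 0 := by
  obtain ⟨c, hc⟩ := h.2 r a
  rw [hc, mul_assoc, hab, mul_zero]

/-- A duo ring is reflexive exactly when it is reversible. -/
lemma IsDuoRing.not_isReflexiveRing_iff (h : IsDuoRing R) :
    ¬ IsReflexiveRing R ↔ ∃ u v : R, v * u = 0 ∧ u * v ≠ 0 := by
  constructor
  · intro hR
    simp only [IsReflexiveRing, not_forall] at hR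
    obtain ⟨v, u, huv, r, hr⟩ := hR
    exact ⟨u, v, by simpa using huv 1, fun h0 => hr (h.mul_mul_eq_zero h0 r)⟩
  · rintro ⟨u, v, hvu, huv⟩ hR
    exact huv (by simpa using hR v u (h.mul_mul_eq_zero hvu) 1)

lemma IsDuoRing.of_surjective {S : Type*} [Ring S] (h : IsDuoRing R) (f : R →+* S)
    (hf : Function.Surjective f) : IsDuoRing S := by
  constructor <;> intro a b <;> obtain ⟨a, rfl⟩ := hf a <;> obtain ⟨b, rfl⟩ := hf b
  · obtain ⟨c, hc⟩ := h.1 a b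
    exact ⟨f c, by rw [← map_mul, hc, map_mul]⟩
  · obtain ⟨c, hc⟩ := h.2 a b
    exact ⟨f c, by rw [← map_mul, hc, map_mul]⟩

lemma IsDuoRing.not_isReflexiveRing_of_injective {S : Type*} [Ring S] (hR : IsDuoRing R)
    (hS : IsDuoRing S) (f : R →+* S) (hf : Function.Injective f) (h : ¬ IsReflexiveRing R) :
    ¬ IsReflexiveRing S := by
  obtain ⟨u, v, hvu, huv⟩ := hR.not_isReflexiveRing_iff.1 h
  refine hS.not_isReflexiveRing_iff.2 ⟨f u, f v, by rw [← map_mul, hvu, map_zero], ?_⟩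
  rwa [← map_mul, Ne, map_eq_zero_iff f hf]

lemma IsDuoRing.isTwoSided (h : IsDuoRing R) (I : Ideal R) : I.IsTwoSided where
  mul_mem_of_left {x} b hx := by
    obtain ⟨c, hc⟩ := h.2 b x
    rw [hc]
    exact I.mul_mem_left c hx

end DuoRings

/-! ### Chains of subgroups in groups of small order -/

section Subgroups

variable {G : Type*} [AddCommGroup G] [Finite G]

lemma AddSubgroup.two_mul_card_le_of_lt {H K : AddSubgroup G} (h : H < K) :
    2 * Nat.card H ≤ Nat.card K := by
  obtain ⟨k, hk⟩ := AddSubgroup.card_dvd_of_le h.le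
  have hne : k ≠ 1 := by
    rintro rfl
    exact h.ne (AddSubgroup.eq_of_le_of_card_ge h.le (by omega))
  have hpos : 0 < Nat.card K := Nat.card_pos
  have : k ≠ 0 := by
    rintro rfl
    omega
  rw [hk, mul_comm]
  exact Nat.mul_le_mul_left _ (by omega)

lemma AddSubgroup.mem_or_sub_mem_of_card {H K : AddSubgroup G} (h : H ≤ K)
    (hcard : Nat.card K = 2 * Nat.card H) {k x : G} (hk : k ∈ K) (hkH : k ∉ H) (hx : x ∈ K) :
    x ∈ H ∨ x - k ∈ H := by
  have hpos : 0 < Nat.card H := Nat.card_pos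
  have hidx : H.relIndex K = 2 := by
    have := (H.addSubgroupOf K).card_mul_index
    rw [Nat.card_congr (AddSubgroup.addSubgroupOfEquivOfLe h).toEquiv, hcard, mul_comm] at this
    exact Nat.eq_of_mul_eq_mul_right hpos this
  obtain ⟨a, -, ha⟩ := AddSubgroup.relIndex_eq_two_iff.1 hidx
  by_contra! hcon
  have h1 : k + a ∈ H := by
    rcases ha k hk with h | h
    exacts [h.1, absurd h.1 hkH]
  have h2 : x + a ∈ H := by
    rcases ha x hx with h | h
    exacts [h.1, absurd h.1 hcon.1]
  exact hcon.2 (by simpa using H.sub_mem h2 h1)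

/-- A strict chain `0 < A < B < C < G` in a group of order at most `16` forces order `16`, with all
indices equal to two. -/
lemma AddSubgroup.card_of_chain {A B C : AddSubgroup G} (hA : A ≠ ⊥) (hAB : A < B) (hBC : B < C)
    (hC : C < ⊤) (hG : Nat.card G ≤ 16) :
    Nat.card A = 2 ∧ Nat.card B = 4 ∧ Nat.card C = 8 ∧ Nat.card G = 16 := by
  have h0 := two_mul_card_le_of_lt (bot_lt_iff_ne_bot.2 hA)
  have h1 := two_mul_card_le_of_lt hAB
  have h2 := two_mul_card_le_of_lt hBC
  have h3 := two_mul_card_le_of_lt hC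
  rw [AddSubgroup.card_bot] at h0
  rw [AddSubgroup.card_top] at h3
  omega

end Subgroups

/-! ### Principal right ideals in local rings -/

section Local

variable {R : Type*} [Ring R]

/-- The principal right ideal `aR`, as an additive subgroup. -/
def rightMultiples (a : R) : AddSubgroup R := (AddMonoidHom.mulLeft a).range

lemma mem_rightMultiples {a x : R} : x ∈ rightMultiples a ↔ ∃ r, a * r = x := Iff.rfl

lemma mul_mem_rightMultiples (a r : R) : a * r ∈ rightMultiples a := ⟨r, rfl⟩

lemma self_mem_rightMultiples (a : R) : a ∈ rightMultiples a := ⟨1, mul_one a⟩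

lemma rightMultiples_le_iff {a b : R} :
    rightMultiples a ≤ rightMultiples b ↔ a ∈ rightMultiples b := by
  refine ⟨fun h => h (self_mem_rightMultiples a), ?_⟩
  rintro ⟨r, rfl⟩ _ ⟨y, rfl⟩
  exact ⟨r * y, (mul_assoc _ _ _).symm⟩

lemma rightMultiples_lt {a b : R} (h : a ∈ rightMultiples b) (h' : b ∉ rightMultiples a) :
    rightMultiples a < rightMultiples b :=
  lt_of_le_not_ge (rightMultiples_le_iff.2 h) (fun hle => h' (rightMultiples_le_iff.1 hle))

/-- In a finite ring, each element has an idempotent power. If all nonzero principal right ideals share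
a nonzero element, the only idempotents are `0` and `1`, since `eR ∩ (1 - e)R = 0`. -/
lemma isNilpotent_or_isUnit_of_forall_mem_rightMultiples [Finite R] {s : R} (hs : s ≠ 0)
    (h : ∀ a : R, a ≠ 0 → s ∈ rightMultiples a) (a : R) : IsNilpotent a ∨ IsUnit a := by
  have hidem : ∀ e : R, e * e = e → e = 0 ∨ e = 1 := by
    intro e he
    by_contra! hcon
    obtain ⟨x, hx⟩ := h e hcon.1
    obtain ⟨y, hy⟩ := h (1 - e) (sub_ne_zero.2 hcon.2.symm)
    change e * x = s at hx
    change (1 - e) * y = s at hy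
    have h1 : e * s = s := by rw [← hx, ← mul_assoc, he]
    have h2 : e * s = 0 := by rw [← hy, ← mul_assoc, mul_sub, he, mul_one, sub_self, zero_mul]
    exact hs (h1 ▸ h2)
  obtain ⟨m, n, hmn, hpow⟩ := Finite.exists_ne_map_eq_of_infinite (fun n : ℕ => a ^ (n + 1))
  wlog hlt : m < n generalizing m n
  · exact this n m hmn.symm hpow.symm (by omega)
  obtain ⟨k, rfl⟩ := Nat.exists_eq_add_of_lt hlt
  -- Powers of `a` beyond `m` have period `k + 1`, so `a ^ ((m + 1) * (k + 1))` is idempotent.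
  have hper : ∀ i j, a ^ (m + 1 + j + i * (k + 1)) = a ^ (m + 1 + j) := by
    intro i
    induction i with
    | zero => simp
    | succ i ih =>
      intro j
      rw [show m + 1 + j + (i + 1) * (k + 1) = (m + k + 1 + 1) + (j + i * (k + 1)) by ring, pow_add,
        ← hpow, ← pow_add, ← ih j]
      ring_nf
  have he := hper (m + 1) ((m + 1) * k)
  rw [show m + 1 + (m + 1) * k + (m + 1) * (k + 1) = (m + 1) * (k + 1) + (m + 1) * (k + 1) by ring,
    show m + 1 + (m + 1) * k = (m + 1) * (k + 1) by ring, pow_add] at he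
  rcases hidem _ he with h0 | h1
  · exact Or.inl ⟨_, h0⟩
  · exact Or.inr (IsUnit.of_pow_eq_one h1 (by positivity))

lemma eq_zero_of_mul_eq_left (hloc : ∀ a : R, IsNilpotent a ∨ IsUnit a) {a x : R}
    (hx : ¬ IsUnit x) (h : a = a * x) : a = 0 := by
  have hu : IsUnit (1 - x) := ((hloc x).resolve_right hx).isUnit_one_sub
  rw [← hu.mul_left_eq_zero, mul_sub, mul_one, ← h, sub_self]

lemma eq_zero_of_mul_eq_right (hloc : ∀ a : R, IsNilpotent a ∨ IsUnit a) {a x : R}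
    (hx : ¬ IsUnit x) (h : a = x * a) : a = 0 := by
  have hu : IsUnit (1 - x) := ((hloc x).resolve_right hx).isUnit_one_sub
  rw [← hu.mul_right_eq_zero, sub_mul, one_mul, ← h, sub_self]

lemma not_isUnit_mul_left [Finite R] {a : R} (r : R) (ha : ¬ IsUnit a) : ¬ IsUnit (a * r) :=
  fun h => ha (isUnit_of_mul_isUnit_left h)

/-- If `R = {0, 1} + uR` with `u` nilpotent, every element is a sum of powers of `u`. -/
lemma commute_of_mem_or_sub_one_mem {u : R} (hu : IsNilpotent u)
    (h : ∀ x : R, x ∈ rightMultiples u ∨ x - 1 ∈ rightMultiples u) (x : R) : Commute x u := by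
  have key : ∀ n : ℕ, ∃ c y, Commute c u ∧ x = c + u ^ n * y := by
    intro n
    induction n with
    | zero => exact ⟨0, x, Commute.zero_left u, by simp⟩
    | succ n ih =>
      obtain ⟨c, y, hc, hx⟩ := ih
      rcases h y with ⟨z, hz⟩ | ⟨z, hz⟩ <;> change u * z = _ at hz
      · exact ⟨c, z, hc, by rw [hx, ← hz, pow_succ, mul_assoc]⟩
      · refine ⟨c + u ^ n, z, hc.add_left ((Commute.refl u).pow_left n), ?_⟩
        rw [hx, pow_succ, mul_assoc, hz, mul_sub, mul_one]
        abel
  obtain ⟨n, hn⟩ := hu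
  obtain ⟨c, y, hc, hx⟩ := key n
  rwa [hx, hn, zero_mul, add_zero]

end Local

/-! ### Nonreflexive duo rings of order at most sixteen -/

section Classification

variable {R : Type*} [Ring R]

lemma not_isUnit_of_mul_eq_zero {u v : R} (hvu : v * u = 0) (huv : u * v ≠ 0) :
    ¬ IsUnit u ∧ ¬ IsUnit v := by
  constructor
  · intro h
    exact huv (by rw [h.mul_left_eq_zero.1 hvu, mul_zero])
  · intro h
    exact huv (by rw [h.mul_right_eq_zero.1 hvu, zero_mul])

lemma rightMultiples_ne_bot {a : R} (ha : a ≠ 0) : rightMultiples a ≠ ⊥ := fun h =>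
  ha (by simpa [h] using self_mem_rightMultiples a)

variable [Finite R]

lemma rightMultiples_mul_lt (hR : IsDuoRing R) (hloc : ∀ a : R, IsNilpotent a ∨ IsUnit a) {u v : R}
    (hvu : v * u = 0) (huv : u * v ≠ 0) :
    rightMultiples (u * v) < rightMultiples u ∧ rightMultiples (u * v) < rightMultiples v := by
  obtain ⟨hu, hv⟩ := not_isUnit_of_mul_eq_zero hvu huv
  constructor
  · refine rightMultiples_lt (mul_mem_rightMultiples u v) ?_
    rintro ⟨r, hr⟩
    change u * v * r = u at hr
    rw [mul_assoc] at hr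
    refine huv ?_
    rw [eq_zero_of_mul_eq_left hloc (not_isUnit_mul_left r hv) hr.symm, zero_mul]
  · obtain ⟨c, hc⟩ := hR.1 v u
    refine rightMultiples_lt ⟨c, hc.symm⟩ ?_
    rintro ⟨r, hr⟩
    change u * v * r = v at hr
    obtain ⟨d, hd⟩ := hR.2 r v
    rw [mul_assoc, hd, ← mul_assoc] at hr
    refine huv ?_
    rw [eq_zero_of_mul_eq_right hloc (not_isUnit_mul_left d hu) hr.symm, mul_zero]

lemma rightMultiples_lt_top {u : R} (hu : ¬ IsUnit u) : rightMultiples u < ⊤ := by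
  refine lt_top_iff_ne_top.2 fun h => ?_
  obtain ⟨r, hr⟩ := mem_rightMultiples.1 (h ▸ AddSubgroup.mem_top (1 : R))
  exact not_isUnit_mul_left r hu (hr ▸ isUnit_one)

/-- If `wR` sits on top of a chain `0 < A < B < wR` in a ring of order at most `16`, then `wR` has index
two, so `R = {0, 1} + wR` and `w` is central. -/
lemma commute_of_chain (hloc : ∀ a : R, IsNilpotent a ∨ IsUnit a) (hcard : Nat.card R ≤ 16)
    {A B : AddSubgroup R} {w : R} (hw : ¬ IsUnit w) (hA : A ≠ ⊥) (hAB : A < B)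
    (hB : B < rightMultiples w) (x : R) : Commute x w := by
  have htop := rightMultiples_lt_top hw
  obtain ⟨-, -, h8, h16⟩ := AddSubgroup.card_of_chain hA hAB hB htop hcard
  refine commute_of_mem_or_sub_one_mem ((hloc w).resolve_right hw) (fun y => ?_) x
  refine AddSubgroup.mem_or_sub_mem_of_card htop.le ?_ (AddSubgroup.mem_top _) ?_
    (AddSubgroup.mem_top _)
  · rw [AddSubgroup.card_top]; omega
  · intro h
    obtain ⟨r, hr⟩ := mem_rightMultiples.1 h
    exact not_isUnit_mul_left r hw (hr ▸ isUnit_one)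

/-- The ideals `uR` and `vR` are incomparable: if one of them contained the other, `commute_of_chain`
would make its generator central, against `v * u = 0 ≠ u * v`. -/
lemma notMem_rightMultiples (hR : IsDuoRing R) (hloc : ∀ a : R, IsNilpotent a ∨ IsUnit a)
    (hcard : Nat.card R ≤ 16) {u v : R} (hvu : v * u = 0) (huv : u * v ≠ 0) :
    v ∉ rightMultiples u ∧ u ∉ rightMultiples v := by
  obtain ⟨hu, hv⟩ := not_isUnit_of_mul_eq_zero hvu huv
  obtain ⟨hsu, hsv⟩ := rightMultiples_mul_lt hR hloc hvu huv
  have hs := rightMultiples_ne_bot huv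
  have hnot : ¬ (v ∈ rightMultiples u ∧ u ∈ rightMultiples v) := by
    rintro ⟨⟨r, hr⟩, ⟨r', hr'⟩⟩
    change u * r = v at hr
    change v * r' = u at hr'
    obtain ⟨c, hc⟩ := hR.2 r' v
    refine huv ?_
    calc u * v = c * v * (u * r) := by rw [← hc, hr', hr]
      _ = c * (v * u) * r := by simp only [mul_assoc]
      _ = 0 := by rw [hvu, mul_zero, zero_mul]
  constructor
  · intro h
    have := commute_of_chain hloc hcard hu hs hsv (rightMultiples_lt h fun h' => hnot ⟨h, h'⟩) v
    exact huv (this.eq ▸ hvu)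
  · intro h
    have := commute_of_chain hloc hcard hv hs hsu (rightMultiples_lt h fun h' => hnot ⟨h', h⟩) u
    exact huv (this.eq.trans hvu)

/-- The chains `0 < uvR < uR < uR + vR < R` and `0 < uvR < vR < uR + vR < R` have all indices two, which
leaves so few candidates for `u²`, `v²` and `2` that the relations follow. -/
lemma exists_socleRelations_of_local (hR : IsDuoRing R)
    (hloc : ∀ a : R, IsNilpotent a ∨ IsUnit a) (hcard : Nat.card R ≤ 16) {u v : R}
    (hvu : v * u = 0) (huv : u * v ≠ 0) :
    Nat.card R = 16 ∧ ∃ t, SocleRelations t u v := by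
  obtain ⟨hu, hv⟩ := not_isUnit_of_mul_eq_zero hvu huv
  obtain ⟨hsu, hsv⟩ := rightMultiples_mul_lt hR hloc hvu huv
  obtain ⟨hvnu, hunv⟩ := notMem_rightMultiples hR hloc hcard hvu huv
  -- `M` turns out to be the maximal ideal: it has index two and contains no units.
  set M := rightMultiples u ⊔ rightMultiples v with hM
  have huM : rightMultiples u < M := lt_of_le_of_ne le_sup_left fun h =>
    hvnu (h ▸ (le_sup_right : _ ≤ M) (self_mem_rightMultiples v))
  have hvM : rightMultiples v < M := lt_of_le_of_ne le_sup_right fun h =>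
    hunv (h ▸ (le_sup_left : _ ≤ M) (self_mem_rightMultiples u))
  have hmemM : ∀ {x}, x ∈ M → ∃ a b, x = u * a + v * b := by
    intro x hx
    obtain ⟨_, ⟨a, rfl⟩, _, ⟨b, rfl⟩, rfl⟩ := AddSubgroup.mem_sup.1 hx
    exact ⟨a, b, rfl⟩
  have hM1 : (1 : R) ∉ M := by
    intro h
    obtain ⟨a, b, hab⟩ := hmemM h
    refine not_isUnit_mul_left b hv ?_
    rw [← sub_eq_iff_eq_add'.2 hab]
    exact ((hloc _).resolve_right (not_isUnit_mul_left a hu)).isUnit_one_sub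
  have hMtop : M < ⊤ := lt_top_iff_ne_top.2 fun h => hM1 (h ▸ AddSubgroup.mem_top _)
  have hMunit : ∀ {x}, x ∈ M → ¬ IsUnit x := by
    rintro x hx ⟨y, rfl⟩
    obtain ⟨a, b, hab⟩ := hmemM hx
    refine hM1 ?_
    rw [← y.mul_inv, hab, add_mul, mul_assoc, mul_assoc]
    exact add_mem ((le_sup_left : _ ≤ M) (mul_mem_rightMultiples u _))
      ((le_sup_right : _ ≤ M) (mul_mem_rightMultiples v _))
  have huM' : u ∈ M := huM.le (self_mem_rightMultiples u)
  have hvM' : v ∈ M := hvM.le (self_mem_rightMultiples v)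
  obtain ⟨h2, h4, h8, h16⟩ :=
    AddSubgroup.card_of_chain (rightMultiples_ne_bot huv) hsu huM hMtop hcard
  obtain ⟨-, h4', -, -⟩ :=
    AddSubgroup.card_of_chain (rightMultiples_ne_bot huv) hsv hvM hMtop hcard
  have hS : ∀ {x}, x ∈ rightMultiples (u * v) → x = 0 ∨ x = u * v := by
    intro x hx
    have := AddSubgroup.mem_or_sub_mem_of_card bot_le (by rw [h2, AddSubgroup.card_bot])
      (self_mem_rightMultiples (u * v)) (by simpa using huv) hx
    simpa [sub_eq_zero] using this
  have hU : ∀ {x}, x ∈ rightMultiples u → x = 0 ∨ x = u * v ∨ x = u ∨ x = u + u * v := by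
    intro x hx
    rcases AddSubgroup.mem_or_sub_mem_of_card hsu.le (by omega) (self_mem_rightMultiples u)
      (fun h => hsu.not_ge (rightMultiples_le_iff.2 h)) hx with h | h
    · rcases hS h with h | h <;> simp [h]
    · rcases hS h with h | h <;> simp [sub_eq_iff_eq_add'.1 h]
  have hV : ∀ {x}, x ∈ rightMultiples v → x = 0 ∨ x = u * v ∨ x = v ∨ x = v + u * v := by
    intro x hx
    rcases AddSubgroup.mem_or_sub_mem_of_card hsv.le (by omega) (self_mem_rightMultiples v)
      (fun h => hsv.not_ge (rightMultiples_le_iff.2 h)) hx with h | h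
    · rcases hS h with h | h <;> simp [h]
    · rcases hS h with h | h <;> simp [sub_eq_iff_eq_add'.1 h]
  have hR2 : ∀ x, x ∈ M ∨ x - 1 ∈ M := fun x =>
    AddSubgroup.mem_or_sub_mem_of_card hMtop.le (by rw [AddSubgroup.card_top]; omega)
      (AddSubgroup.mem_top _) hM1 (AddSubgroup.mem_top x)
  have hMUV : ∀ {x}, x ∈ M → x ∈ rightMultiples u ∨ x - v ∈ rightMultiples u := fun hx =>
    AddSubgroup.mem_or_sub_mem_of_card huM.le (by omega) hvM' hvnu hx
  have hu0 : u ≠ 0 := by rintro rfl; simp at huv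
  have hv0 : v ≠ 0 := by rintro rfl; simp at huv
  have hunS : u ≠ u * v := fun h => hu0 (eq_zero_of_mul_eq_left hloc hv h)
  have hvnS : v ≠ u * v := fun h => hv0 (eq_zero_of_mul_eq_right hloc hu h)
  have uuv : u * (u * v) = 0 := by
    obtain ⟨c, hc⟩ := hR.1 (u * v) u
    rcases hS ⟨c, hc.symm⟩ with h | h
    · exact h
    · exact absurd (eq_zero_of_mul_eq_right hloc hu h.symm) huv
  have uvu : u * v * u = 0 := by rw [mul_assoc, hvu, mul_zero]
  -- A square equal to `w` or `w + uv` would give `w = w * x` or `w = x * w` with `x` a nonunit.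
  have huu : u * u = 0 ∨ u * u = u * v := by
    rcases hU (mul_mem_rightMultiples u u) with h | h | h | h
    · exact Or.inl h
    · exact Or.inr h
    · exact absurd (eq_zero_of_mul_eq_left hloc hu h.symm) hu0
    · refine absurd (eq_zero_of_mul_eq_left hloc (hMunit (sub_mem huM' hvM')) ?_) hu0
      rw [mul_sub, h, add_sub_cancel_right]
  have hvv : v * v = 0 ∨ v * v = u * v := by
    rcases hV (mul_mem_rightMultiples v v) with h | h | h | h
    · exact Or.inl h
    · exact Or.inr h
    · exact absurd (eq_zero_of_mul_eq_left hloc hv h.symm) hv0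
    · refine absurd (eq_zero_of_mul_eq_right hloc (hMunit (sub_mem hvM' huM')) ?_) hv0
      rw [sub_mul, h, add_sub_cancel_right]
  -- If `u² = 0`, then `Ru = {0, u}` misses `uv`, although `uv ∈ uR = Ru`; similarly for `v`.
  have uu : u * u = u * v := by
    refine huu.resolve_left fun h0 => ?_
    obtain ⟨c, hc⟩ := hR.2 v u
    have hMu : ∀ {x}, x ∈ M → x * u = 0 := by
      intro x hx
      obtain ⟨a, b, rfl⟩ := hmemM hx
      rw [add_mul, hR.mul_mul_eq_zero h0, hR.mul_mul_eq_zero hvu, add_zero]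
    rcases hR2 c with h | h
    · exact huv (hc.trans (hMu h))
    · have := hMu h
      rw [sub_mul, ← hc, one_mul, sub_eq_zero] at this
      exact hunS this.symm
  have vv : v * v = u * v := by
    refine hvv.resolve_left fun h0 => ?_
    obtain ⟨c, hc⟩ := hR.1 v u
    have hMv : ∀ {x}, x ∈ M → v * x = 0 := by
      intro x hx
      obtain ⟨a, b, rfl⟩ := hmemM hx
      rw [mul_add, ← mul_assoc, ← mul_assoc, hvu, h0, zero_mul, zero_mul, add_zero]
    rcases hR2 c with h | h
    · exact huv (hc.trans (hMv h))
    · have := hMv h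
      rw [mul_sub, ← hc, mul_one, sub_eq_zero] at this
      exact hvnS this.symm
  -- The central element `2` has no component along `u` or `v`, as none of `u`, `v`, `u + v` commutes
  -- with both `u` and `v`.
  have h2c : ∀ x : R, (1 + 1) * x = x * (1 + 1) := fun x => by
    rw [add_mul, mul_add, one_mul, mul_one]
  have hcu := h2c u
  have hcv := h2c v
  have h2M : (1 : R) + 1 ∈ M := (hR2 (1 + 1)).resolve_right (by simpa using hM1)
  have uvv : u * v * v = 0 := by rw [mul_assoc, vv, uuv]
  have vuv : v * (u * v) = 0 := by rw [← mul_assoc, hvu, zero_mul]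
  have htwo : (1 : R) + 1 = 0 ∨ (1 : R) + 1 = u * v := by
    rcases hMUV h2M with h | h
    · rcases hU h with h | h | h | h
      · exact Or.inl h
      · exact Or.inr h
      · rw [h, hvu] at hcv
        exact absurd hcv huv
      · rw [h, add_mul, mul_add, hvu, uvv, vuv, add_zero, add_zero] at hcv
        exact absurd hcv huv
    · exfalso
      rcases hU h with h | h | h | h <;> rw [sub_eq_iff_eq_add] at h <;>
        simp only [h, add_mul, mul_add, hvu, uvv, vuv, uvu, uuv, uu, vv, zero_add, add_zero,
          left_eq_add] at hcu hcv
      · exact huv hcu.symm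
      · exact huv hcu.symm
      · exact huv hcu
      · exact huv hcu
  have hwu : u + u = 0 := by
    have : u + u = u * (1 + 1) := by rw [mul_add, mul_one]
    rcases htwo with h | h <;> rw [this, h]
    exacts [mul_zero u, uuv]
  have hwv : v + v = 0 := by
    have : v + v = v * (1 + 1) := by rw [mul_add, mul_one]
    rcases htwo with h | h <;> rw [this, h]
    exacts [mul_zero v, vuv]
  refine ⟨h16, ?_⟩
  rcases htwo with h | h
  · exact ⟨0, hvu, uu, vv, uuv, hwu, hwv, by simpa using h⟩
  · exact ⟨1, hvu, uu, vv, uuv, hwu, hwv, by rw [h, ZMod.val_one, one_smul]⟩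

end Classification

/-- A nonreflexive duo ring of order at most `16` has order exactly `16` and contains `u`, `v` with
`uv ≠ 0` satisfying the socle relations. A nonzero ideal `aR` missing `uv` could be factored out,
giving a smaller nonreflexive duo ring, so by induction all nonzero ideals contain `uv` and the ring is local. -/
theorem exists_socleRelations (n : ℕ) : ∀ (R : Type u) [Ring R] [Finite R], Nat.card R = n →
    n ≤ 16 → IsDuoRing R → ¬ IsReflexiveRing R →
    Nat.card R = 16 ∧ ∃ (t : ZMod 2) (u v : R), SocleRelations t u v ∧ u * v ≠ 0 := by
  induction n using Nat.strong_induction_on with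
  | _ n ih =>
  intro R _ _ hn hn16 hR hrefl
  obtain ⟨u, v, hvu, huv⟩ := hR.not_isReflexiveRing_iff.1 hrefl
  by_cases hsoc : ∀ a : R, a ≠ 0 → u * v ∈ rightMultiples a
  · obtain ⟨h16, t, ht⟩ := exists_socleRelations_of_local hR
      (isNilpotent_or_isUnit_of_forall_mem_rightMultiples huv hsoc) (hn ▸ hn16) hvu huv
    exact ⟨h16, t, u, v, ht, huv⟩
  · exfalso
    push Not at hsoc
    obtain ⟨a, ha, has⟩ := hsoc
    have := hR.isTwoSided (Ideal.span {a})
    have hmem : u * v ∉ Ideal.span {a} := by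
      rw [Ideal.mem_span_singleton']
      rintro ⟨c, hc⟩
      obtain ⟨d, hd⟩ := hR.1 a c
      exact has ⟨d, hd.symm.trans hc⟩
    have hsurj := Ideal.Quotient.mk_surjective (I := Ideal.span {a})
    have : Finite (R ⧸ Ideal.span {a}) := Finite.of_surjective _ hsurj
    have hlt : Nat.card (R ⧸ Ideal.span {a}) < Nat.card R := by
      refine lt_of_le_of_ne (Nat.card_le_card_of_surjective _ hsurj) fun h => ha ?_
      have hinj := (Nat.bijective_iff_surjective_and_card _).2 ⟨hsurj, h.symm⟩ |>.1
      apply hinj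
      rw [map_zero, Ideal.Quotient.eq_zero_iff_mem]
      exact Ideal.mem_span_singleton_self a
    have hquot := hR.of_surjective _ hsurj
    have := (ih _ (hn ▸ hlt) (R ⧸ Ideal.span {a}) rfl (by omega) hquot
      (hquot.not_isReflexiveRing_iff.2 ⟨Ideal.Quotient.mk _ u, Ideal.Quotient.mk _ v,
        by rw [← map_mul, hvu, map_zero],
        by rwa [← map_mul, Ne, Ideal.Quotient.eq_zero_iff_mem]⟩)).1
    omega

/-! ### Presentations and minimality -/

namespace SocleModel

variable {t : ZMod 2}

lemma not_isReflexiveRing : ¬ IsReflexiveRing (SocleModel t) := by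
  rw [isDuoRing.not_isReflexiveRing_iff]
  exact ⟨⟨0, 1, 0, 0⟩, ⟨0, 0, 1, 0⟩, by simp, by simp⟩

lemma two_nsmul_eq (x : SocleModel t) : 2 • x = ⟨0, 0, 0, t * x.one⟩ := by
  rw [two_nsmul]
  ext <;> simp [bit_add_self, bit_mul_self]

lemma four_nsmul_eq_zero (x : SocleModel t) : 4 • x = 0 := by
  rw [show 4 = 2 * 2 from rfl, mul_nsmul, two_nsmul_eq, two_nsmul_eq]
  simp

end SocleModel

/-- If the relations `S` over `ℤ/n` imply the socle relations and hold in `SocleModel t`, they present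
`SocleModel t`. -/
lemma nonempty_socleModel_ringEquiv {n : ℕ} [NeZero n] {t : ZMod 2}
    (hn : ∀ x : SocleModel t, n • x = 0) (S : Set (FreeAlgebra (ZMod n) (Fin 2)))
    (hrel : ∀ (B : Type) [Ring B] (q : FreeAlgebra (ZMod n) (Fin 2) →+* B), (∀ x ∈ S, q x = 0) →
      SocleRelations t (q (genU (ZMod n))) (q (genV (ZMod n))))
    (hS : ∀ f : FreeAlgebra (ZMod n) (Fin 2) →+* SocleModel t,
      f (genU (ZMod n)) = ⟨0, 1, 0, 0⟩ → f (genV (ZMod n)) = ⟨0, 0, 1, 0⟩ → ∀ x ∈ S, f x = 0) :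
    Nonempty (SocleModel t ≃+* (TwoSidedIdeal.span S).ringCon.Quotient) := by
  have hrel := hrel _ (TwoSidedIdeal.span S).ringCon.mk' fun x hx => by
    rw [← TwoSidedIdeal.mem_ker, TwoSidedIdeal.ker_ringCon_mk']
    exact TwoSidedIdeal.subset_span hx
  refine ⟨RingEquiv.ofBijective hrel.hom ⟨hrel.hom_injective fun h0 => ?_, fun y => ?_⟩⟩
  · let : Module (ZMod n) (SocleModel t) := AddCommGroup.zmodModule hn
    let : Algebra (ZMod n) (SocleModel t) := ZMod.algebraOfModule n _
    let f : FreeAlgebra (ZMod n) (Fin 2) →ₐ[ZMod n] SocleModel t :=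
      FreeAlgebra.lift (ZMod n) ![⟨0, 1, 0, 0⟩, ⟨0, 0, 1, 0⟩]
    have hu : f (genU (ZMod n)) = ⟨0, 1, 0, 0⟩ := FreeAlgebra.lift_ι_apply _ _
    have hv : f (genV (ZMod n)) = ⟨0, 0, 1, 0⟩ := FreeAlgebra.lift_ι_apply _ _
    have hle : TwoSidedIdeal.span S ≤ TwoSidedIdeal.ker f.toRingHom :=
      TwoSidedIdeal.span_le.2 fun x hx => (TwoSidedIdeal.mem_ker _).2 (hS f.toRingHom hu hv x hx)
    rw [← map_mul, ← TwoSidedIdeal.mem_ker, TwoSidedIdeal.ker_ringCon_mk'] at h0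
    have h1 : f (genU (ZMod n) * genV (ZMod n)) = 0 := (TwoSidedIdeal.mem_ker _).1 (hle h0)
    rw [map_mul, hu, hv] at h1
    simp at h1
  · obtain ⟨x, rfl⟩ := (TwoSidedIdeal.span S).ringCon.mk'_surjective y
    change _ ∈ hrel.hom.range
    induction x using FreeAlgebra.induction with
    | grade0 r =>
      rw [← ZMod.natCast_zmod_val r, map_natCast, map_natCast]
      exact natCast_mem _ _
    | grade1 i =>
      fin_cases i
      · exact ⟨_, hrel.hom_u⟩
      · exact ⟨_, hrel.hom_v⟩
    | mul x y hx hy => rw [map_mul]; exact mul_mem hx hy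
    | add x y hx hy => rw [map_add]; exact add_mem hx hy

lemma nonempty_socleModel_zero_ringEquiv : Nonempty (SocleModel 0 ≃+* RingF2) := by
  refine nonempty_socleModel_ringEquiv
    (fun x => by rw [SocleModel.two_nsmul_eq, zero_mul]; rfl) _ ?_ ?_
  · intro B _ q hq
    have h1 : q (genU (ZMod 2) ^ 3) = 0 := hq _ (by simp)
    have h3 : q (genV (ZMod 2) * genU (ZMod 2)) = 0 := hq _ (by simp)
    have h4 : q (genU (ZMod 2) ^ 2 - genU (ZMod 2) * genV (ZMod 2)) = 0 :=
      hq _ (by simp)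
    have h5 : q (genV (ZMod 2) ^ 2 - genU (ZMod 2) * genV (ZMod 2)) = 0 :=
      hq _ (by simp)
    have h2 : q 2 = 0 := by
      rw [show (2 : FreeAlgebra (ZMod 2) (Fin 2)) = algebraMap (ZMod 2) _ 2 from
          (map_ofNat (algebraMap (ZMod 2) _) 2).symm,
        show (2 : ZMod 2) = 0 from rfl, map_zero, map_zero]
    simp only [map_sub, map_mul, map_ofNat, sub_eq_zero, pow_succ, pow_zero,
      one_mul] at h1 h2 h3 h4 h5
    rw [← one_add_one_eq_two] at h2
    refine ⟨h3, h4, h5, by rw [← h4, ← mul_assoc, h1], ?_, ?_, by simpa using h2⟩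
    · rw [← mul_one (q _), ← mul_add, h2, mul_zero]
    · rw [← mul_one (q _), ← mul_add, h2, mul_zero]
  · rintro f hu hv x (rfl | rfl | rfl | rfl | rfl) <;>
      simp [hu, hv, pow_succ, sub_eq_add_neg, SocleModel.bit_add_self]

lemma nonempty_socleModel_one_ringEquiv : Nonempty (SocleModel 1 ≃+* RingZ4) := by
  refine nonempty_socleModel_ringEquiv SocleModel.four_nsmul_eq_zero _ ?_ ?_
  · intro B _ q hq
    have h1 : q (genU (ZMod 4) ^ 3) = 0 := hq _ (by simp)
    have h3 : q (genV (ZMod 4) * genU (ZMod 4)) = 0 := hq _ (by simp)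
    have h4 : q (genU (ZMod 4) ^ 2 - genU (ZMod 4) * genV (ZMod 4)) = 0 :=
      hq _ (by simp)
    have h5 : q (genV (ZMod 4) ^ 2 - genU (ZMod 4) * genV (ZMod 4)) = 0 :=
      hq _ (by simp)
    have h2 : q (2 - genU (ZMod 4) * genV (ZMod 4)) = 0 :=
      hq _ (by simp)
    have h6 : q (2 * genU (ZMod 4)) = 0 := hq _ (by simp)
    have h7 : q (2 * genV (ZMod 4)) = 0 := hq _ (by simp)
    simp only [map_sub, map_mul, map_add, map_ofNat, sub_eq_zero, pow_succ, pow_zero,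
      one_mul, two_mul] at h1 h2 h3 h4 h5 h6 h7
    refine ⟨h3, h4, h5, by rw [← h4, ← mul_assoc, h1], h6, h7, ?_⟩
    rw [one_add_one_eq_two, h2, ZMod.val_one, one_smul]
  · rintro f hu hv x hx
    have h2 : f 2 = ⟨0, 0, 0, 1⟩ := (map_ofNat f 2).trans (one_add_one_eq_two.symm.trans rfl)
    rcases hx with (rfl | rfl | rfl | rfl | rfl | rfl | rfl | rfl) <;>
      simp [hu, hv, h2, pow_succ, sub_eq_add_neg, SocleModel.bit_add_self]

lemma isMinimalNonreflexiveDuoRing_iff (R : Type u) [Ring R] :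
    IsMinimalNonreflexiveDuoRing R ↔ ∃ t, Nonempty (R ≃+* SocleModel t) := by
  constructor
  · rintro ⟨⟨hR, hrefl⟩, hmin⟩
    let e : SocleModel 0 ≃+* ULift.{u} (SocleModel 0) := ULift.ringEquiv.symm
    have hduo := SocleModel.isDuoRing.of_surjective e.toRingHom e.surjective
    have hle := hmin _ hduo (SocleModel.isDuoRing.not_isReflexiveRing_of_injective hduo e.toRingHom
      e.injective SocleModel.not_isReflexiveRing)
    have hfin : Finite R := by
      rw [← Cardinal.mk_lt_aleph0_iff]
      exact hle.trans_lt (Cardinal.mk_lt_aleph0_iff.2 inferInstance)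
    have hcard : Nat.card R ≤ 16 := by
      have := Cardinal.toNat_le_toNat hle (Cardinal.mk_lt_aleph0_iff.2 inferInstance)
      rwa [← Nat.card, ← Nat.card, Nat.card_congr e.symm.toEquiv, SocleModel.card] at this
    obtain ⟨h16, t, u, v, h, huv⟩ := exists_socleRelations _ R rfl hcard hR hrefl
    refine ⟨t, ⟨(RingEquiv.ofBijective h.hom ?_).symm⟩⟩
    rw [Nat.bijective_iff_injective_and_card]
    exact ⟨h.hom_injective huv, by rw [SocleModel.card, h16]⟩
  · rintro ⟨t, ⟨e⟩⟩
    have hR : IsDuoRing R :=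
      SocleModel.isDuoRing.of_surjective e.symm.toRingHom e.symm.surjective
    refine ⟨⟨hR, SocleModel.isDuoRing.not_isReflexiveRing_of_injective hR e.symm.toRingHom
      e.symm.injective SocleModel.not_isReflexiveRing⟩, fun S _ hS hSr => ?_⟩
    have : Finite R := .of_equiv _ e.symm.toEquiv
    rcases finite_or_infinite S with hfin | hinf
    · have h16 : 16 ≤ Nat.card S := by
        by_contra! hlt
        have := (exists_socleRelations _ S rfl hlt.le hS hSr).1
        omega
      rw [← Nat.cast_card, ← Nat.cast_card, Nat.cast_le, Nat.card_congr e.toEquiv,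
        SocleModel.card]
      exact h16
    · exact (Cardinal.mk_lt_aleph0_iff.2 this).le.trans (Cardinal.aleph0_le_mk_iff.2 hinf)

theorem mainTheorem1 :
    (∀ (R : Type u) [Ring R], IsMinimalNonreflexiveDuoRing R → Nat.card R = 16) ∧
    (∀ (R : Type u) [Ring R], IsMinimalNonreflexiveDuoRing R ↔
      Nonempty (R ≃+* RingF2) ∨ Nonempty (R ≃+* RingZ4)) ∧
    IsEmpty (RingF2 ≃+* RingZ4) := by
  obtain ⟨e₀⟩ := nonempty_socleModel_zero_ringEquiv
  obtain ⟨e₁⟩ := nonempty_socleModel_one_ringEquiv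
  refine ⟨fun R _ hR => ?_, fun R _ => ?_, ⟨fun e => ?_⟩⟩
  · obtain ⟨t, ⟨e⟩⟩ := (isMinimalNonreflexiveDuoRing_iff R).1 hR
    rw [Nat.card_congr e.toEquiv, SocleModel.card]
  · rw [isMinimalNonreflexiveDuoRing_iff]
    constructor
    · rintro ⟨t, ⟨e⟩⟩
      rcases SocleModel.bit_cases t with rfl | rfl
      exacts [Or.inl ⟨e.trans e₀⟩, Or.inr ⟨e.trans e₁⟩]
    · rintro (⟨⟨e⟩⟩ | ⟨⟨e⟩⟩)
      exacts [⟨0, ⟨e.trans e₀.symm⟩⟩, ⟨1, ⟨e.trans e₁.symm⟩⟩]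
  · -- The additive exponents are `2` and `4`.
    let f := (e₀.trans e).trans e₁.symm
    have h : f (2 • 1) = 2 • 1 := by rw [map_nsmul, map_one]
    rw [SocleModel.two_nsmul_eq, SocleModel.two_nsmul_eq, zero_mul, ← SocleModel.zero_def,
      map_zero] at h
    simp at h
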